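/- Let $n \ge 1$ be an integer and let $K$ be a real number. There are constants $C, A > 0$, depending only on $n$ and $K$, with the following property. For every integer $m \ge 1$, let $a_1, \dots, a_m$ be independent random points, each uniformly distributed on the unit sphere $S^{n-1} \subset \mathbb{R}^n$, and let $P$ be their convex hull. Then, with probability at least $1 - A/m^K$, the polytope $P$ has at most $C\, m\, (\log m)^{n-1}$ facets, where a facet of $P$ is a nonempty face of $P$ of dimension $\dim P - 1$. (For $n = 1$ the factor $(\log m)^{n-1}$ is read as $1$.) -/

import Mathlib

open MeasureTheory Metric

/-- The uniform probability measure on the unit sphere `S^{n-1}` of `ℝⁿ` (for `n ≥ 1`):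
the surface measure induced by Lebesgue measure, divided by its total mass. -/
noncomputable def uniformSphere (n : ℕ) :
    Measure (sphere (0 : EuclideanSpace ℝ (Fin n)) 1) :=
  ((volume : Measure (EuclideanSpace ℝ (Fin n))).toSphere Set.univ)⁻¹ •
    (volume : Measure (EuclideanSpace ℝ (Fin n))).toSphere

/-- The joint law of `m` independent uniform random points on `S^{n-1}`. -/
noncomputable def uniformPoints (n m : ℕ) :
    Measure (Fin m → sphere (0 : EuclideanSpace ℝ (Fin n)) 1) :=
  Measure.pi fun _ => uniformSphere n

/-- The polytope spanned by `m` points of the sphere: their convex hull in `ℝⁿ`. -/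
def spherePolytope {n m : ℕ} (a : Fin m → sphere (0 : EuclideanSpace ℝ (Fin n)) 1) :
    Set (EuclideanSpace ℝ (Fin n)) :=
  convexHull ℝ (Set.range fun i => (a i : EuclideanSpace ℝ (Fin n)))

/-- `F` is a facet of the polytope `P`: a nonempty face of `P` (the intersection of `P` with a
supporting hyperplane) whose affine dimension is one less than that of `P`. -/
def IsFacet {n : ℕ} (P F : Set (EuclideanSpace ℝ (Fin n))) : Prop :=
  IsExposed ℝ P F ∧ F.Nonempty ∧
    Module.finrank ℝ (vectorSpan ℝ F) + 1 = Module.finrank ℝ (vectorSpan ℝ P)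

/-- The set of facets of `P`. -/
def facets {n : ℕ} (P : Set (EuclideanSpace ℝ (Fin n))) :
    Set (Set (EuclideanSpace ℝ (Fin n))) :=
  {F | IsFacet P F}

/-- `P` has finitely many facets, and their number is at most `b`. -/
def FacetCountLE {n : ℕ} (P : Set (EuclideanSpace ℝ (Fin n))) (b : ℝ) : Prop :=
  (facets P).Finite ∧ ((facets P).ncard : ℝ) ≤ b

/-!
Put `d = n - 1` and let `r` be the scale with `r ^ d = B * log m / m`. A cap of radius `r` on
`S^{n-1}` has uniform measure of order `r ^ d` (`le_uniformSphere_ball`, `uniformSphere_ball_le`),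
so it is expected to contain about `B * log m` of the random points, and for a large constant `B`
this holds with very high probability, up to a constant factor, for all caps at once: there is an
`r / 2`-net with `O(m / log m)` points (`exists_net_card_mul_le_one`), and a union bound over it
shows that, up to probability `O(m ^ (-K))`, every cap of radius `r / 2` around a net point contains
a random point (`pi_real_forall_notMem_le`) while every cap of radius `3 * r / 2` around one contains
at most `O(log m)` of them (`pi_real_le_card_filter_mem_le`).

On this event every facet is local. The open cap beyond the facet hyperplane contains no random
point, and every cap of radius `r` contains one; hence the points on the facet are within `r` of its
outer unit normal (`IsFacet.exists_dist_lt`) and within `3 * r / 2` of some net point. Moreover a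
facet is the intersection of the polytope with the affine span of `n` of its generating points
(`IsFacet.exists_vertices`); no general position is needed for this. So the number of facets is at
most the number of pairs of a net point and an `n`-tuple of random points near it, which is
`O(m / log m) * O(log m) ^ n = O(m * (log m) ^ (n - 1))` (`facetCountLE_of_cover`).

In dimension one the scale `r` is not available, but there the same count with a single set of all
indices gives at most `m` facets.
-/

/-! ### Facets are determined by few vertices, all lying in an empty cap -/

/-- An exposed face of a convex hull is affinely spanned by those of the generating points that lie
on it: in a convex combination on which a functional is maximal, every point carrying a positive
weight is itself a maximiser. -/
lemma IsExposed.subset_affineSpan {V ι : Type*} [NormedAddCommGroup V] [NormedSpace ℝ V]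
    {v : ι → V} {F : Set V} (hF : IsExposed ℝ (convexHull ℝ (Set.range v)) F) :
    F ⊆ affineSpan ℝ (Set.range v ∩ F) := by
  intro x hx
  obtain ⟨l, hl⟩ := hF ⟨x, hx⟩
  have hx' := hx
  rw [hl] at hx'
  obtain ⟨hxP, hmax⟩ := hx'
  obtain ⟨κ, _, w, z, hw0, hw1, hz, rfl⟩ := mem_convexHull_iff_exists_fintype.1 hxP
  have hzP : ∀ k, z k ∈ convexHull ℝ (Set.range v) := fun k => subset_convexHull ℝ _ (hz k)
  set x := ∑ k, w k • z k with hxdef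
  have hsum : ∑ k, w k * (l x - l (z k)) = 0 := by
    simp only [mul_sub, Finset.sum_sub_distrib, ← Finset.sum_mul, hw1, one_mul]
    simp [hxdef, map_sum]
  have hzero := (Finset.sum_eq_zero_iff_of_nonneg (fun k _ =>
    mul_nonneg (hw0 k) (sub_nonneg.2 (hmax _ (hzP k))))).1 hsum
  refine convexHull_subset_affineSpan _ ?_
  have h1 : ∑ k with w k ≠ 0, w k • z k = x := by
    rw [hxdef]
    exact Finset.sum_filter_of_ne fun k _ h hk => h (by simp [hk])
  rw [← h1]
  refine (convex_convexHull ℝ _).sum_mem (fun k _ => hw0 k) ?_ fun k hk => ?_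
  · rw [← hw1]
    exact Finset.sum_filter_of_ne fun k _ h hk => h (by simp [hk])
  · refine subset_convexHull ℝ _ ⟨hz k, ?_⟩
    rw [hl]
    refine ⟨hzP k, fun y hy => (hmax y hy).trans ?_⟩
    have := (mul_eq_zero.1 (hzero k (Finset.mem_univ k))).resolve_left (Finset.mem_filter.1 hk).2
    linarith

/-- An exposed face of `P` is cut out of `P` by its own affine span. -/
lemma IsExposed.eq_inter_affineSpan {V : Type*} [NormedAddCommGroup V] [NormedSpace ℝ V]
    {P F : Set V} (hF : IsExposed ℝ P F) (hne : F.Nonempty) :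
    F = P ∩ affineSpan ℝ F := by
  refine Set.Subset.antisymm (fun x hx => ⟨hF.subset hx, _root_.subset_affineSpan ℝ F hx⟩) ?_
  rintro x ⟨hxP, hx⟩
  obtain ⟨l, hl⟩ := hF hne
  obtain ⟨y, hy⟩ := hne
  have hle : affineSpan ℝ F ≤
      (AffineSubspace.mk' (l y) ⊥).comap (l : V →ₗ[ℝ] ℝ).toAffineMap := by
    refine affineSpan_le.2 fun z hz => ?_
    have h1 := hz
    have h2 := hy
    rw [hl] at h1 h2
    have : l z = l y := le_antisymm (h2.2 z h1.1) (h1.2 y h2.1)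
    simp [AffineSubspace.mem_mk', this]
  have hxy : l x = l y := by
    have := hle hx
    simpa [AffineSubspace.mem_comap, AffineSubspace.mem_mk', sub_eq_zero] using this
  rw [hl] at hy ⊢
  exact ⟨hxP, fun z hz => hxy ▸ hy.2 z hz⟩

/-- A nonempty set is affinely spanned by a family of `d` of its points, possibly repeated, as soon
as `d` exceeds the dimension of its affine span. -/
lemma exists_fin_affineSpan_eq {V : Type*} [AddCommGroup V] [Module ℝ V]
    [FiniteDimensional ℝ V] {s : Set V} (hs : s.Nonempty) {d : ℕ}
    (hd : Module.finrank ℝ (vectorSpan ℝ s) + 1 ≤ d) :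
    ∃ g : Fin d → V, (∀ j, g j ∈ s) ∧ affineSpan ℝ (Set.range g) = affineSpan ℝ s := by
  obtain ⟨t, hts, hspan, hind⟩ := exists_affineIndependent ℝ V s
  have : Finite t := finite_of_fin_dim_affineIndependent ℝ hind
  have := Fintype.ofFinite t
  have hcard : Fintype.card t ≤ d := by
    refine (hind.card_le_finrank_succ).trans (le_trans ?_ hd)
    rw [Subtype.range_coe]
    exact Nat.succ_le_succ (Submodule.finrank_mono (vectorSpan_mono ℝ hts))
  have hne : Nonempty t := by
    rw [Set.nonempty_coe_sort]
    refine (affineSpan_nonempty (k := ℝ)).1 ?_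
    rw [hspan]
    exact (affineSpan_nonempty (k := ℝ)).2 hs
  obtain ⟨e⟩ : Nonempty (t ↪ Fin d) := Function.Embedding.nonempty_of_card_le (by simpa using hcard)
  obtain ⟨g, hg⟩ : ∃ g : Fin d → t, Function.Surjective g :=
    ⟨Function.invFun e, Function.invFun_surjective e.injective⟩
  refine ⟨fun j => g j, fun j => hts (g j).2, ?_⟩
  rw [← hspan]
  congr 1
  ext x
  constructor
  · rintro ⟨j, rfl⟩
    exact (g j).2
  · intro hx
    obtain ⟨j, hj⟩ := hg ⟨x, hx⟩
    exact ⟨j, by simp [hj]⟩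

/-- A facet of a sphere polytope is recovered from `n` of the chosen points on it. -/
lemma IsFacet.exists_vertices {n m : ℕ} {a : Fin m → sphere (0 : EuclideanSpace ℝ (Fin n)) 1}
    {F : Set (EuclideanSpace ℝ (Fin n))} (hF : IsFacet (spherePolytope a) F) :
    ∃ f : Fin n → Fin m, (∀ j, (a (f j) : EuclideanSpace ℝ (Fin n)) ∈ F) ∧
      F = spherePolytope a ∩
        affineSpan ℝ (Set.range fun j => (a (f j) : EuclideanSpace ℝ (Fin n))) := by
  obtain ⟨hexp, hne, hdim⟩ := hF
  set v : Fin m → EuclideanSpace ℝ (Fin n) := fun i => a i with hv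
  have hspan : affineSpan ℝ (Set.range v ∩ F) = affineSpan ℝ F :=
    le_antisymm (affineSpan_mono ℝ Set.inter_subset_right)
      (affineSpan_le.2 hexp.subset_affineSpan)
  have hne' : (Set.range v ∩ F).Nonempty := by
    refine (affineSpan_nonempty (k := ℝ)).1 ?_
    rw [hspan]
    exact (affineSpan_nonempty (k := ℝ)).2 hne
  have hd : Module.finrank ℝ (vectorSpan ℝ (Set.range v ∩ F)) + 1 ≤ n := by
    rw [← direction_affineSpan, hspan, direction_affineSpan, hdim]
    simpa using Submodule.finrank_le (vectorSpan ℝ (spherePolytope a))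
  obtain ⟨g, hg, hgspan⟩ := exists_fin_affineSpan_eq hne' hd
  choose f hf using fun j => (hg j).1
  refine ⟨f, fun j => ?_, ?_⟩
  · have := (hg j).2
    rwa [← hf j] at this
  · have hfg : (fun j => (a (f j) : EuclideanSpace ℝ (Fin n))) = g := funext hf
    rw [hfg, hgspan, hspan]
    exact hexp.eq_inter_affineSpan hne

/-- If every ball of radius `r` centred on the sphere contains one of the points, then the points
on a facet lie in one such ball, centred at the outer unit normal of the facet: the ball contains
a point `a i` on the inner side of the facet hyperplane, and the points on the facet are at least as
close to the normal as `a i`. -/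
lemma IsFacet.exists_dist_lt {n m : ℕ} {a : Fin m → sphere (0 : EuclideanSpace ℝ (Fin n)) 1}
    {F : Set (EuclideanSpace ℝ (Fin n))} (hF : IsFacet (spherePolytope a) F) {r : ℝ}
    (hr : ∀ u : sphere (0 : EuclideanSpace ℝ (Fin n)) 1, ∃ i, dist (a i) u < r) :
    ∃ u : sphere (0 : EuclideanSpace ℝ (Fin n)) 1,
      ∀ i, (a i : EuclideanSpace ℝ (Fin n)) ∈ F → dist (a i) u < r := by
  obtain ⟨hexp, hne, hdim⟩ := hF
  obtain ⟨l, hl⟩ := hexp hne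
  set w := (InnerProductSpace.toDual ℝ (EuclideanSpace ℝ (Fin n))).symm l with hw
  have hlw : ∀ x, inner ℝ w x = l x := fun x => by simp [hw]
  have hw0 : w ≠ 0 := by
    intro h0
    have hl0 : ∀ x, l x = 0 := fun x => by rw [← hlw, h0, inner_zero_left]
    have : F = spherePolytope a := by
      rw [hl]
      ext x
      simp [hl0]
    rw [this] at hdim
    omega
  have hwpos : 0 < ‖w‖ := norm_pos_iff.2 hw0
  refine ⟨⟨‖w‖⁻¹ • w, by simp [norm_smul, hwpos.ne']⟩, fun i hi => ?_⟩
  obtain ⟨i₀, hi₀⟩ := hr ⟨‖w‖⁻¹ • w, by simp [norm_smul, hwpos.ne']⟩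
  rw [Subtype.dist_eq, dist_eq_norm] at hi₀ ⊢
  refine lt_of_le_of_lt ?_ hi₀
  rw [hl] at hi
  have hle := hi.2 _ (subset_convexHull ℝ _ (Set.mem_range_self i₀))
  rw [← hlw, ← hlw] at hle
  refine (sq_le_sq₀ (norm_nonneg _) (norm_nonneg _)).1 ?_
  have h1 : ∀ j, ‖(a j : EuclideanSpace ℝ (Fin n))‖ = 1 := fun j => by simp
  rw [norm_sub_sq_real, norm_sub_sq_real, h1, h1, inner_smul_right, inner_smul_right,
    real_inner_comm, real_inner_comm (F := EuclideanSpace ℝ (Fin n)) w]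
  have := mul_le_mul_of_nonneg_left hle (inv_nonneg.2 hwpos.le)
  linarith

/-- Counting of facets: if for every facet some set of the cover `J` contains the indices of all
the points on it, then there are at most `#N * k ^ n` facets, `k` bounding the sizes in the cover. -/
lemma facetCountLE_of_cover {n m : ℕ} {a : Fin m → sphere (0 : EuclideanSpace ℝ (Fin n)) 1}
    {α : Type*} (N : Finset α) (J : α → Finset (Fin m)) {k : ℕ} (hk : ∀ z ∈ N, (J z).card ≤ k)
    (hJ : ∀ F, IsFacet (spherePolytope a) F →
      ∃ z ∈ N, ∀ i, (a i : EuclideanSpace ℝ (Fin n)) ∈ F → i ∈ J z)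
    {b : ℝ} (hb : (N.card * k ^ n : ℝ) ≤ b) :
    FacetCountLE (spherePolytope a) b := by
  classical
  set T : Finset (Set (EuclideanSpace ℝ (Fin n))) := N.biUnion fun z =>
    (Fintype.piFinset fun _ : Fin n => J z).image fun f => spherePolytope a ∩
        affineSpan ℝ (Set.range fun j => (a (f j) : EuclideanSpace ℝ (Fin n))) with hT
  have hsub : facets (spherePolytope a) ⊆ T := by
    intro F hF
    obtain ⟨f, hf, hFf⟩ := IsFacet.exists_vertices hF
    obtain ⟨z, hz, hzJ⟩ := hJ F hF
    simp only [hT, Finset.coe_biUnion, Set.mem_iUnion, Finset.mem_coe, Finset.mem_image,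
      Fintype.mem_piFinset]
    exact ⟨z, hz, f, fun j => hzJ _ (hf j), hFf.symm⟩
  have hcard : T.card ≤ N.card * k ^ n := by
    refine Finset.card_biUnion_le_card_mul _ _ _ fun z hz => Finset.card_image_le.trans ?_
    rw [Fintype.card_piFinset]
    simpa using Nat.pow_le_pow_left (hk z hz) n
  refine ⟨T.finite_toSet.subset hsub, le_trans ?_ hb⟩
  have := (Set.ncard_le_ncard hsub T.finite_toSet).trans ((Set.ncard_coe_finset T).le.trans hcard)
  exact_mod_cast this

/-! ### The measure of a spherical cap -/

section Cap

open scoped Pointwise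

instance isProbabilityMeasure_uniformSphere (n : ℕ) [NeZero n] :
    IsProbabilityMeasure (uniformSphere n) := by
  constructor
  have h0 : (volume : Measure (EuclideanSpace ℝ (Fin n))).toSphere Set.univ ≠ 0 := by
    rw [Measure.measure_univ_ne_zero]
    exact Measure.toSphere_ne_zero _
  rw [uniformSphere, Measure.smul_apply, smul_eq_mul]
  exact ENNReal.inv_mul_cancel h0 (measure_ne_top _ _)

/-- The open cone with apex `0` over a subset of the unit sphere, cut off by the unit ball. -/
def sphereCone {n : ℕ} (s : Set (sphere (0 : EuclideanSpace ℝ (Fin n)) 1)) :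
    Set (EuclideanSpace ℝ (Fin n)) :=
  Set.Ioo (0 : ℝ) 1 • ((↑) '' s)

lemma mem_sphereCone {n : ℕ} {s : Set (sphere (0 : EuclideanSpace ℝ (Fin n)) 1)}
    {x : EuclideanSpace ℝ (Fin n)} :
    x ∈ sphereCone s ↔ ∃ t : ℝ, 0 < t ∧ t < 1 ∧ ∃ y ∈ s, t • (y : EuclideanSpace ℝ (Fin n)) = x := by
  simp only [sphereCone, Set.mem_smul, Set.mem_Ioo, Set.mem_image]
  constructor
  · rintro ⟨t, ⟨h0, h1⟩, _, ⟨y, hy, rfl⟩, rfl⟩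
    exact ⟨t, h0, h1, y, hy, rfl⟩
  · rintro ⟨t, h0, h1, y, hy, rfl⟩
    exact ⟨t, ⟨h0, h1⟩, _, ⟨y, hy, rfl⟩, rfl⟩

lemma sphereCone_subset_ball {n : ℕ} (s : Set (sphere (0 : EuclideanSpace ℝ (Fin n)) 1)) :
    sphereCone s ⊆ ball 0 1 := by
  intro x hx
  obtain ⟨t, h0, h1, y, -, rfl⟩ := mem_sphereCone.1 hx
  simpa [norm_smul, abs_of_pos h0] using h1

lemma volume_real_unitBall_pos (n : ℕ) :
    0 < volume.real (ball (0 : EuclideanSpace ℝ (Fin n)) 1) :=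
  ENNReal.toReal_pos (measure_ball_pos _ _ one_pos).ne' measure_ball_lt_top.ne

lemma uniformSphere_real_eq {n : ℕ} [NeZero n]
    {s : Set (sphere (0 : EuclideanSpace ℝ (Fin n)) 1)} (hs : MeasurableSet s) :
    (uniformSphere n).real s * volume.real (ball (0 : EuclideanSpace ℝ (Fin n)) 1) =
      volume.real (sphereCone s) := by
  have hn : (n : ℝ) ≠ 0 := by exact_mod_cast NeZero.ne n
  have hV : volume.real (ball (0 : EuclideanSpace ℝ (Fin n)) 1) ≠ 0 :=
    (volume_real_unitBall_pos n).ne'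
  have h1 : (volume : Measure (EuclideanSpace ℝ (Fin n))).toSphere.real s =
      n * volume.real (sphereCone s) := by
    rw [measureReal_def, Measure.toSphere_apply' _ hs, ENNReal.toReal_mul]
    simp [measureReal_def, sphereCone]
  have h2 : (uniformSphere n).real s =
      ((volume : Measure (EuclideanSpace ℝ (Fin n))).toSphere.real Set.univ)⁻¹ *
        (volume : Measure (EuclideanSpace ℝ (Fin n))).toSphere.real s := by
    simp [uniformSphere, measureReal_def, ENNReal.toReal_inv]
  rw [h2, h1, Measure.toSphere_real_apply_univ, finrank_euclideanSpace_fin]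
  field_simp

lemma measurableSet_sphereCone_ball {n : ℕ} (u : sphere (0 : EuclideanSpace ℝ (Fin n)) 1) (r : ℝ) :
    MeasurableSet (sphereCone (ball u r)) :=
  (isOpen_Ioo.smul_sphere one_ne_zero (by simp) isOpen_ball).measurableSet

/-- The outer shell `C \ t • C` of the cone `C` over a cap has volume `(1 - t ^ n)` times that of
`C`, hence proportional to the measure of the cap. -/
lemma volume_real_shell {n : ℕ} [NeZero n] (u : sphere (0 : EuclideanSpace ℝ (Fin n)) 1) (r : ℝ)
    {t : ℝ} (ht0 : 0 < t) (ht1 : t ≤ 1) :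
    volume.real (sphereCone (ball u r) \ t • sphereCone (ball u r)) =
      (1 - t ^ n) * ((uniformSphere n).real (ball u r) *
        volume.real (ball (0 : EuclideanSpace ℝ (Fin n)) 1)) := by
  have hfin : volume (sphereCone (ball u r)) ≠ ⊤ :=
    ((measure_mono (sphereCone_subset_ball _)).trans_lt measure_ball_lt_top).ne
  have hsmul : volume.real (t • sphereCone (ball u r)) =
      t ^ n * volume.real (sphereCone (ball u r)) := by
    rw [measureReal_def, Measure.addHaar_smul, ENNReal.toReal_mul, finrank_euclideanSpace_fin,
      abs_of_nonneg (by positivity), ENNReal.toReal_ofReal (by positivity), measureReal_def]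
  have hsub : t • sphereCone (ball u r) ⊆ sphereCone (ball u r) := by
    rintro _ ⟨x, hx, rfl⟩
    obtain ⟨s, h0, h1, y, hy, rfl⟩ := mem_sphereCone.1 hx
    exact mem_sphereCone.2 ⟨t * s, by positivity, by nlinarith, y, hy, by simp [mul_smul]⟩
  rw [uniformSphere_real_eq isOpen_ball.measurableSet,
    measureReal_sdiff hsub ((measurableSet_sphereCone_ball u r).const_smul₀ t) hfin, hsmul]
  ring

lemma volume_real_ball_eq {n : ℕ} [NeZero n] (x : EuclideanSpace ℝ (Fin n)) {r : ℝ} (hr : 0 ≤ r) :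
    volume.real (ball x r) = r ^ n * volume.real (ball (0 : EuclideanSpace ℝ (Fin n)) 1) := by
  rw [measureReal_def, Measure.addHaar_ball _ _ hr, ENNReal.toReal_mul, finrank_euclideanSpace_fin,
    ENNReal.toReal_ofReal (by positivity), measureReal_def]

/-- Upper bound on the measure of a cap: its shell of thickness `r` fits into a ball of
radius `2 * r`. -/
lemma uniformSphere_ball_le {n : ℕ} [NeZero n] (u : sphere (0 : EuclideanSpace ℝ (Fin n)) 1)
    {r : ℝ} (hr0 : 0 < r) (hr1 : r < 1) :
    (uniformSphere n).real (ball u r) ≤ 2 ^ n * r ^ (n - 1) := by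
  have hV : 0 < volume.real (ball (0 : EuclideanSpace ℝ (Fin n)) 1) :=
    volume_real_unitBall_pos n
  have hsub : sphereCone (ball u r) \ (1 - r) • sphereCone (ball u r) ⊆
      ball (u : EuclideanSpace ℝ (Fin n)) (2 * r) := by
    rintro x ⟨hx, hx'⟩
    obtain ⟨s, h0, h1, y, hy, rfl⟩ := mem_sphereCone.1 hx
    have hs : 1 - r ≤ s := by
      by_contra! hlt
      refine hx' ⟨(s / (1 - r)) • (y : EuclideanSpace ℝ (Fin n)), mem_sphereCone.2
        ⟨_, by positivity, (div_lt_one (by linarith)).2 hlt, y, hy, rfl⟩, ?_⟩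
      have : 1 - r ≠ 0 := by linarith
      simp only [smul_smul]
      congr 1
      field_simp
    have hyu : dist (y : EuclideanSpace ℝ (Fin n)) u < r := hy
    have hsy : dist (s • (y : EuclideanSpace ℝ (Fin n))) y = 1 - s := by
      have : s • (y : EuclideanSpace ℝ (Fin n)) - y = (s - 1) • (y : EuclideanSpace ℝ (Fin n)) := by
        rw [sub_smul, one_smul]
      rw [dist_eq_norm, this, norm_smul, Real.norm_eq_abs, abs_of_neg (by linarith)]
      simp
    rw [mem_ball]
    linarith [dist_triangle (s • (y : EuclideanSpace ℝ (Fin n))) y u]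
  have hmono := measureReal_mono (μ := volume) hsub measure_ball_lt_top.ne
  rw [volume_real_shell u r (by linarith) (by linarith),
    volume_real_ball_eq (r := 2 * r) _ (by positivity),
    ← mul_assoc] at hmono
  have h1 := le_of_mul_le_mul_right hmono hV
  have h2 : (1 - r) ^ n ≤ 1 - r := pow_le_of_le_one (by linarith) (by linarith) (NeZero.ne n)
  have h3 : r * (uniformSphere n).real (ball u r) ≤ r * (2 ^ n * r ^ (n - 1)) := by
    calc r * (uniformSphere n).real (ball u r)
        ≤ (1 - (1 - r) ^ n) * (uniformSphere n).real (ball u r) :=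
          mul_le_mul_of_nonneg_right (by linarith) measureReal_nonneg
      _ ≤ (2 * r) ^ n := h1
      _ = r * (2 ^ n * r ^ (n - 1)) := by
          rw [mul_pow, ← mul_pow_sub_one (NeZero.ne n) r]
          ring
  exact le_of_mul_le_mul_left h3 hr0

/-- Lower bound on the measure of a cap: its shell of thickness `r / 2` contains a ball of
radius `r / 4`. -/
lemma le_uniformSphere_ball {n : ℕ} [NeZero n] (u : sphere (0 : EuclideanSpace ℝ (Fin n)) 1)
    {r : ℝ} (hr0 : 0 < r) (hr1 : r < 1) :
    (r / 4) ^ (n - 1) / (2 * n) ≤ (uniformSphere n).real (ball u r) := by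
  have hV : 0 < volume.real (ball (0 : EuclideanSpace ℝ (Fin n)) 1) :=
    volume_real_unitBall_pos n
  have hn : (0 : ℝ) < n := by exact_mod_cast NeZero.pos n
  obtain ⟨s, rfl⟩ : ∃ s, r = 4 * s := ⟨r / 4, by ring⟩
  have hs : 0 < s := by linarith
  have hsub : ball ((1 - s) • (u : EuclideanSpace ℝ (Fin n))) s ⊆
      sphereCone (ball u (4 * s)) \ (1 - 2 * s) • sphereCone (ball u (4 * s)) := by
    intro x hx
    have hu : ‖(u : EuclideanSpace ℝ (Fin n))‖ = 1 := by simp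
    have hcu : ‖(1 - s) • (u : EuclideanSpace ℝ (Fin n))‖ = 1 - s := by
      rw [norm_smul, hu, Real.norm_eq_abs, abs_of_pos (by linarith), mul_one]
    rw [mem_ball, dist_eq_norm] at hx
    have hup : ‖x‖ < 1 := by linarith [norm_sub_norm_le x ((1 - s) • (u : EuclideanSpace ℝ (Fin n)))]
    have hlo : 1 - 2 * s < ‖x‖ := by
      have := norm_sub_norm_le ((1 - s) • (u : EuclideanSpace ℝ (Fin n))) x
      rw [norm_sub_rev] at this
      linarith
    have hpos : 0 < ‖x‖ := by linarith
    refine ⟨mem_sphereCone.2 ⟨‖x‖, hpos, hup, ⟨‖x‖⁻¹ • x, ?_⟩, ?_, ?_⟩, ?_⟩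
    · simp [norm_smul, hpos.ne']
    · rw [mem_ball, Subtype.dist_eq, dist_eq_norm]
      have e : ‖x‖⁻¹ • x - u = (‖x‖⁻¹ - 1) • x + (x - (1 - s) • (u : EuclideanSpace ℝ (Fin n)))
          + (-s) • (u : EuclideanSpace ℝ (Fin n)) := by
        module
      have h1 : ‖(‖x‖⁻¹ - 1) • x‖ = 1 - ‖x‖ := by
        rw [norm_smul, Real.norm_eq_abs, abs_of_nonneg (by linarith [(one_lt_inv₀ hpos).2 hup]),
          sub_mul, inv_mul_cancel₀ hpos.ne', one_mul]
      have h2 : ‖(-s) • (u : EuclideanSpace ℝ (Fin n))‖ = s := by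
        rw [norm_smul, hu, norm_neg, Real.norm_eq_abs, abs_of_pos hs, mul_one]
      change ‖‖x‖⁻¹ • x - u‖ < 4 * s
      rw [e]
      refine (norm_add₃_le ..).trans_lt ?_
      linarith
    · simp [smul_smul, hpos.ne']
    · rintro ⟨y, hy, rfl⟩
      have hy1 := sphereCone_subset_ball _ hy
      rw [mem_ball_zero_iff] at hy1
      simp only [norm_smul, Real.norm_eq_abs, abs_of_pos (show 0 < 1 - 2 * s by linarith)] at hlo
      nlinarith
  have hmono := measureReal_mono (μ := volume) hsub
    ((measure_mono (Set.sdiff_subset.trans (sphereCone_subset_ball _))).trans_lt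
      measure_ball_lt_top).ne
  rw [volume_real_shell u _ (by linarith) (by linarith), volume_real_ball_eq _ hs.le,
    ← mul_assoc] at hmono
  have h1 := le_of_mul_le_mul_right hmono hV
  have h2 : 1 - (1 - 2 * s) ^ n ≤ n * (2 * s) := by
    have := one_add_mul_le_pow (a := -(2 * s)) (by linarith) n
    rw [← sub_eq_add_neg] at this
    linarith
  rw [div_le_iff₀ (by positivity)]
  refine le_of_mul_le_mul_left ?_ hs
  calc s * (4 * s / 4) ^ (n - 1) = s ^ n := by
        rw [mul_div_cancel_left₀ _ (by norm_num), mul_pow_sub_one (NeZero.ne n)]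
    _ ≤ (1 - (1 - 2 * s) ^ n) * (uniformSphere n).real (ball u (4 * s)) := h1
    _ ≤ n * (2 * s) * (uniformSphere n).real (ball u (4 * s)) :=
        mul_le_mul_of_nonneg_right h2 measureReal_nonneg
    _ = s * ((uniformSphere n).real (ball u (4 * s)) * (2 * n)) := by ring

end Cap

/-! ### Nets and occupation numbers of independent points -/

/-- If every ball of radius `ρ` has probability at least `p`, then a maximal `2 * ρ`-separated set
is a `2 * ρ`-net with at most `1 / p` points. -/
lemma exists_net_card_mul_le_one {X : Type*} [PseudoMetricSpace X] [MeasurableSpace X]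
    [OpensMeasurableSpace X] (μ : Measure X) [IsProbabilityMeasure μ] {ρ p : ℝ} (hp : 0 < p)
    (hρ : 0 < ρ) (hball : ∀ x, p ≤ μ.real (ball x ρ)) :
    ∃ N : Finset X, N.card * p ≤ 1 ∧ ∀ x, ∃ z ∈ N, dist x z < 2 * ρ := by
  classical
  let Sep : Finset X → Prop := fun S => (S : Set X).Pairwise fun x y => 2 * ρ ≤ dist x y
  have hcard : ∀ S, Sep S → (S.card : ℝ) * p ≤ 1 := by
    intro S hS
    calc (S.card : ℝ) * p = ∑ x ∈ S, p := by simp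
      _ ≤ ∑ x ∈ S, μ.real (ball x ρ) := Finset.sum_le_sum fun x _ => hball x
      _ = μ.real (⋃ x ∈ S, ball x ρ) := by
          refine (measureReal_biUnion_finset (fun x hx y hy hxy => ?_)
            (fun x _ => isOpen_ball.measurableSet)).symm
          exact ball_disjoint_ball (by linarith [hS hx hy hxy])
      _ ≤ 1 := measureReal_le_one
  let T : Set ℕ := {k | ∃ S, Sep S ∧ S.card = k}
  have hne : T.Nonempty := ⟨0, ∅, by simp [Sep], rfl⟩
  have hbdd : BddAbove T := by
    refine ⟨⌊1 / p⌋₊, ?_⟩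
    rintro _ ⟨S, hS, rfl⟩
    exact Nat.le_floor ((le_div_iff₀ hp).2 (hcard S hS))
  obtain ⟨N, hN, hNmax⟩ := Nat.sSup_mem hne hbdd
  refine ⟨N, hcard N hN, fun x => ?_⟩
  by_contra! hx
  have hxN : x ∉ N := fun h => by
    have := hx x h
    rw [dist_self] at this
    linarith
  have hins : Sep (insert x N) := by
    simp only [Sep, Finset.coe_insert]
    refine hN.insert_of_notMem hxN fun y hy => ⟨hx y hy, ?_⟩
    rw [dist_comm]
    exact hx y hy
  have := le_csSup hbdd ⟨_, hins, rfl⟩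
  rw [Finset.card_insert_of_notMem hxN] at this
  omega

section Independent

variable {X : Type*} [MeasurableSpace X]

lemma pi_real_forall_notMem_le (μ : Measure X) [IsProbabilityMeasure μ] {s : Set X}
    (hs : MeasurableSet s) (m : ℕ) :
    (Measure.pi fun _ : Fin m => μ).real {a | ∀ i, a i ∉ s} ≤ Real.exp (-(m * μ.real s)) := by
  have hset : {a : Fin m → X | ∀ i, a i ∉ s} = Set.univ.pi fun _ => sᶜ := by
    ext a
    simp
  rw [hset, measureReal_def, Measure.pi_pi, Finset.prod_const, Finset.card_univ, Fintype.card_fin,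
    ENNReal.toReal_pow, ← measureReal_def, probReal_compl_eq_one_sub hs]
  have h0 : 0 ≤ 1 - μ.real s := sub_nonneg.2 measureReal_le_one
  refine (pow_le_pow_left₀ h0 (Real.one_sub_le_exp_neg _) m).trans_eq ?_
  rw [← Real.exp_nat_mul]
  ring_nf

lemma pi_real_forall_mem (μ : Measure X) [IsProbabilityMeasure μ] (s : Set X) {m : ℕ}
    (S : Finset (Fin m)) :
    (Measure.pi fun _ : Fin m => μ).real {a | ∀ i ∈ S, a i ∈ s} = μ.real s ^ S.card := by
  classical
  have hset : {a : Fin m → X | ∀ i ∈ S, a i ∈ s} =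
      Set.univ.pi fun i => if i ∈ S then s else Set.univ := by
    ext a
    simp only [Set.mem_ofPred_eq, Set.mem_pi, Set.mem_univ, true_implies]
    refine forall_congr' fun i => ?_
    by_cases hi : i ∈ S <;> simp [hi]
  have hprod : ∀ i, μ (if i ∈ S then s else Set.univ) = if i ∈ S then μ s else 1 := by
    intro i
    split_ifs <;> simp
  rw [hset, measureReal_def, Measure.pi_pi, Finset.prod_congr rfl fun i _ => hprod i,
    Finset.prod_ite_mem, Finset.univ_inter, Finset.prod_const, ENNReal.toReal_pow, measureReal_def]

/-- A Chernoff-type bound: a union bound over the `k`-element sets of indices, together with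
`choose m k * q ^ k ≤ exp (-k) * (e * m * q) ^ k / k! ≤ exp (e * m * q - k)`. -/
lemma pi_real_le_card_filter_mem_le (μ : Measure X) [IsProbabilityMeasure μ] (s : Set X)
    [DecidablePred (· ∈ s)] (m k : ℕ) :
    (Measure.pi fun _ : Fin m => μ).real
      {a | k ≤ (Finset.univ.filter fun i => a i ∈ s).card} ≤
      Real.exp (Real.exp 1 * (m * μ.real s) - k) := by
  have hsub : {a : Fin m → X | k ≤ (Finset.univ.filter fun i => a i ∈ s).card} ⊆
      ⋃ S ∈ Finset.powersetCard k (Finset.univ : Finset (Fin m)), {a | ∀ i ∈ S, a i ∈ s} := by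
    intro a ha
    obtain ⟨S, hS, hSk⟩ := Finset.exists_subset_card_eq (Set.mem_ofPred_eq ▸ ha)
    simp only [Set.mem_iUnion]
    exact ⟨S, Finset.mem_powersetCard.2 ⟨Finset.subset_univ _, hSk⟩,
      fun i hi => (Finset.mem_filter.1 (hS hi)).2⟩
  refine (measureReal_mono hsub (measure_ne_top _ _)).trans
    ((measureReal_biUnion_finset_le _ _).trans ?_)
  have hsum : ∑ S ∈ Finset.powersetCard k (Finset.univ : Finset (Fin m)),
      (Measure.pi fun _ : Fin m => μ).real {a | ∀ i ∈ S, a i ∈ s} =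
      m.choose k * μ.real s ^ k := by
    rw [Finset.sum_congr rfl fun S hS => by
      rw [pi_real_forall_mem, (Finset.mem_powersetCard.1 hS).2]]
    simp
  rw [hsum]
  have hq : 0 ≤ μ.real s := measureReal_nonneg
  have hexp := Real.pow_div_factorial_le_exp (Real.exp 1 * (m * μ.real s)) (by positivity) k
  calc (m.choose k : ℝ) * μ.real s ^ k
      ≤ (m : ℝ) ^ k / k.factorial * μ.real s ^ k :=
        mul_le_mul_of_nonneg_right (Nat.choose_le_pow_div k m) (by positivity)
    _ = Real.exp (-k) * ((Real.exp 1 * (m * μ.real s)) ^ k / k.factorial) := by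
        rw [mul_pow (Real.exp 1), mul_pow (m : ℝ), ← Real.exp_nat_mul, mul_one, Real.exp_neg]
        have := (Real.exp_pos k).ne'
        field_simp
    _ ≤ Real.exp (-k) * Real.exp (Real.exp 1 * (m * μ.real s)) :=
        mul_le_mul_of_nonneg_left hexp (Real.exp_pos _).le
    _ = _ := by
        rw [← Real.exp_add]
        ring_nf

end Independent

/-! ### The facet count at a fixed scale -/

instance isProbabilityMeasure_uniformPoints (n m : ℕ) [NeZero n] :
    IsProbabilityMeasure (uniformPoints n m) := by
  unfold uniformPoints
  infer_instance

/-- The facet count at scale `r`. Take an `r / 2`-net `N`; off an exceptional event every cap of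
radius `r / 2` around a net point contains a random point, so that the vertices of each facet lie
in a cap of radius `3 * r / 2` around some net point, and each of these caps contains fewer than
`k` random points. -/
lemma exists_uniformPoints_real_not_facetCountLE_le {n : ℕ} [NeZero n] (m k : ℕ) {r : ℝ}
    (hr0 : 0 < r) (hr1 : 3 * r / 2 < 1) :
    ∃ N : ℕ, N * ((r / 16) ^ (n - 1) / (2 * n)) ≤ 1 ∧
      (uniformPoints n m).real {a | ¬ FacetCountLE (spherePolytope a) (N * (k : ℝ) ^ n)} ≤
        N * (Real.exp (-(m * ((r / 8) ^ (n - 1) / (2 * n)))) +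
          Real.exp (Real.exp 1 * (m * (2 ^ n * (3 * r / 2) ^ (n - 1))) - k)) := by
  classical
  have hn : (0 : ℝ) < n := by exact_mod_cast NeZero.pos n
  have hp : 0 < (r / 16) ^ (n - 1) / (2 * n) := by positivity
  obtain ⟨N, hN, hnet⟩ := exists_net_card_mul_le_one (uniformSphere n) (ρ := r / 4) hp
    (by positivity) fun x => by
      have h := le_uniformSphere_ball x (r := r / 4) (by positivity) (by linarith)
      rwa [div_div, show (4 : ℝ) * 4 = 16 by norm_num] at h
  refine ⟨N.card, hN, ?_⟩
  let E₁ : sphere (0 : EuclideanSpace ℝ (Fin n)) 1 → Set (Fin m → _) :=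
    fun z => {a | ∀ i, a i ∉ ball z (r / 2)}
  let E₂ : sphere (0 : EuclideanSpace ℝ (Fin n)) 1 → Set (Fin m → _) :=
    fun z => {a | k ≤ (Finset.univ.filter fun i => a i ∈ ball z (3 * r / 2)).card}
  have hsub : {a | ¬ FacetCountLE (spherePolytope a) (N.card * (k : ℝ) ^ n)} ⊆
      ⋃ z ∈ N, (E₁ z ∪ E₂ z) := by
    intro a ha
    by_contra hgood
    simp only [Set.mem_iUnion, Set.mem_union, not_exists, not_or] at hgood
    refine ha (facetCountLE_of_cover N
      (fun z => Finset.univ.filter fun i => a i ∈ ball z (3 * r / 2))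
      (fun z hz => (not_le.1 (hgood z hz).2).le) (fun F hF => ?_) le_rfl)
    obtain ⟨u, hu⟩ := IsFacet.exists_dist_lt hF (r := r) fun u => by
      obtain ⟨z, hz, huz⟩ := hnet u
      obtain ⟨i, hi⟩ : ∃ i, a i ∈ ball z (r / 2) := by
        by_contra! h
        exact (hgood z hz).1 h
      refine ⟨i, ?_⟩
      rw [mem_ball] at hi
      rw [dist_comm] at huz
      linarith [dist_triangle (a i) z u]
    obtain ⟨z, hz, huz⟩ := hnet u
    refine ⟨z, hz, fun i hi => Finset.mem_filter.2 ⟨Finset.mem_univ i, ?_⟩⟩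
    rw [mem_ball]
    linarith [dist_triangle (a i) u z, hu i hi]
  have hE₁ : ∀ z, (uniformPoints n m).real (E₁ z) ≤
      Real.exp (-(m * ((r / 8) ^ (n - 1) / (2 * n)))) := by
    intro z
    refine (pi_real_forall_notMem_le (uniformSphere n) isOpen_ball.measurableSet m).trans ?_
    refine Real.exp_le_exp.2 (neg_le_neg (mul_le_mul_of_nonneg_left ?_ m.cast_nonneg))
    have h := le_uniformSphere_ball z (r := r / 2) (by positivity) (by linarith)
    rwa [div_div, show (2 : ℝ) * 4 = 8 by norm_num] at h
  have hE₂ : ∀ z, (uniformPoints n m).real (E₂ z) ≤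
      Real.exp (Real.exp 1 * (m * (2 ^ n * (3 * r / 2) ^ (n - 1))) - k) := by
    intro z
    refine (pi_real_le_card_filter_mem_le (uniformSphere n) (ball z (3 * r / 2)) m k).trans ?_
    gcongr
    exact uniformSphere_ball_le z (by positivity) hr1
  refine (measureReal_mono hsub (measure_ne_top _ _)).trans
    ((measureReal_biUnion_finset_le _ _).trans ?_)
  rw [← nsmul_eq_mul]
  exact Finset.sum_le_card_nsmul _ _ _ fun z _ =>
    (measureReal_union_le _ _).trans (add_le_add (hE₁ z) (hE₂ z))

/-! ### The choice of the scale -/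

/-- The scale `r ^ (n - 1) ≍ log m / m` balances the two error terms: a cap of radius `r` is
expected to contain a large multiple of `log m` points. -/
lemma exists_uniformPoints_real_le_of_large {n : ℕ} (hn : 2 ≤ n) {K : ℝ} (hK : 0 ≤ K) :
    ∃ C : ℝ, 0 < C ∧ ∀ᶠ m : ℕ in Filter.atTop,
      (uniformPoints n m).real
        {a | ¬ FacetCountLE (spherePolytope a) (C * m * Real.log m ^ (n - 1))} ≤
        2 ^ n / (m : ℝ) ^ K := by
  have : NeZero n := ⟨by omega⟩
  obtain ⟨d, rfl⟩ : ∃ d, n = d + 1 := ⟨n - 1, by omega⟩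
  have hd : d ≠ 0 := by omega
  simp only [Nat.add_sub_cancel]
  set ν : ℝ := ((d + 1 : ℕ) : ℝ) with hν
  have hνpos : 0 < ν := by positivity
  -- `B` makes the caps of radius `r / 2` empty with probability at most `m ^ (-(K + 1))`, and
  -- `D * log m` dominates the exponent in the occupation bound for caps of radius `3 * r / 2`.
  set B : ℝ := (K + 1) * (2 * ν) * 8 ^ d with hB
  have hBpos : 0 < B := by positivity
  set D : ℝ := Real.exp 1 * 2 ^ (d + 1) * (3 / 2) ^ d * B with hD
  have hDpos : 0 < D := by positivity
  set L : ℝ := D + K + 2 with hL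
  have hLpos : 0 < L := by positivity
  refine ⟨2 ^ d * L ^ (d + 1), by positivity, ?_⟩
  have hlim : Filter.Tendsto (fun m : ℕ => Real.log m / m) Filter.atTop (nhds 0) :=
    (Real.isLittleO_log_id_atTop.tendsto_div_nhds_zero).comp tendsto_natCast_atTop_atTop
  have hc : 0 < (2 / 3 : ℝ) ^ d / B := by positivity
  have hlog : ∀ᶠ m : ℕ in Filter.atTop, 1 ≤ Real.log m :=
    (Real.tendsto_log_atTop.comp tendsto_natCast_atTop_atTop).eventually_ge_atTop 1
  filter_upwards [hlim.eventually_lt_const hc, hlog, Filter.eventually_gt_atTop 0]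
    with m hm1 hm2 hm3
  have hm : (0 : ℝ) < m := by exact_mod_cast hm3
  set ℓ := Real.log m with hℓ
  have hℓpos : 0 < ℓ := by linarith
  set r : ℝ := (B * (ℓ / m)) ^ (d : ℝ)⁻¹ with hr
  have hr0 : 0 < r := by positivity
  have hrd : r ^ d = B * (ℓ / m) := Real.rpow_inv_natCast_pow (by positivity) hd
  have hr1 : 3 * r / 2 < 1 := by
    have : r ^ d < (2 / 3) ^ d := by
      rw [hrd, mul_comm]
      exact (lt_div_iff₀ hBpos).1 hm1
    have := lt_of_pow_lt_pow_left₀ d (by norm_num) this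
    linarith
  set k : ℕ := ⌈(D + K + 1) * ℓ⌉₊ with hk
  have hk1 : (D + K + 1) * ℓ ≤ k := Nat.le_ceil _
  have hk2 : (k : ℝ) ≤ L * ℓ := by
    have := (Nat.ceil_lt_add_one (show 0 ≤ (D + K + 1) * ℓ by positivity)).le
    rw [← hk] at this
    rw [hL]
    linarith
  obtain ⟨N, hN, hprob⟩ := exists_uniformPoints_real_not_facetCountLE_le (n := d + 1) m k hr0 hr1
  simp only [Nat.add_sub_cancel] at hN hprob
  have hNle : (N : ℝ) ≤ 2 ^ d * (m / ℓ) := by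
    have e : (r / 16) ^ d / (2 * ν) = (K + 1) * (ℓ / m) / 2 ^ d := by
      rw [div_pow, hrd, hB, show (16 : ℝ) = 8 * 2 by norm_num, mul_pow]
      field_simp
    rw [← hν, e] at hN
    have h1 : (N : ℝ) * (ℓ / m / 2 ^ d) ≤ 1 := by
      refine le_trans (mul_le_mul_of_nonneg_left ?_ N.cast_nonneg) hN
      gcongr
      have : 0 ≤ K * (ℓ / m) := by positivity
      linarith
    calc (N : ℝ) = N * (ℓ / m / 2 ^ d) * (2 ^ d * (m / ℓ)) := by field_simp
      _ ≤ 1 * (2 ^ d * (m / ℓ)) := mul_le_mul_of_nonneg_right h1 (by positivity)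
      _ = _ := one_mul _
  have hcount : (N : ℝ) * (k : ℝ) ^ (d + 1) ≤ 2 ^ d * L ^ (d + 1) * m * ℓ ^ d := by
    calc (N : ℝ) * (k : ℝ) ^ (d + 1) ≤ 2 ^ d * (m / ℓ) * (L * ℓ) ^ (d + 1) := by gcongr
      _ = _ := by
        rw [mul_pow, pow_succ ℓ]
        field_simp
  have hsub : {a : Fin m → sphere (0 : EuclideanSpace ℝ (Fin (d + 1))) 1 |
      ¬ FacetCountLE (spherePolytope a) (2 ^ d * L ^ (d + 1) * m * ℓ ^ d)} ⊆
      {a | ¬ FacetCountLE (spherePolytope a) (N * (k : ℝ) ^ (d + 1))} :=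
    fun a ha h => ha ⟨h.1, h.2.trans hcount⟩
  refine (measureReal_mono hsub).trans (hprob.trans ?_)
  have e1 : (m : ℝ) * ((r / 8) ^ d / (2 * ν)) = (K + 1) * ℓ := by
    rw [div_pow, hrd, hB]
    field_simp
  have e2 : Real.exp 1 * (m * (2 ^ (d + 1) * (3 * r / 2) ^ d)) = D * ℓ := by
    rw [show 3 * r / 2 = 3 / 2 * r by ring, mul_pow, hrd, hD]
    field_simp
  rw [← hν, e1, e2]
  have hexp : Real.exp (-((K + 1) * ℓ)) = ((m : ℝ) ^ K)⁻¹ * (m : ℝ)⁻¹ := by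
    rw [hℓ, ← Real.rpow_neg hm.le, ← Real.rpow_neg_one, ← Real.rpow_add hm, Real.rpow_def_of_pos hm]
    ring_nf
  calc (N : ℝ) * (Real.exp (-((K + 1) * ℓ)) + Real.exp (D * ℓ - k))
      ≤ 2 ^ d * (m / ℓ) * (Real.exp (-((K + 1) * ℓ)) + Real.exp (-((K + 1) * ℓ))) := by
        gcongr
        linarith
    _ ≤ 2 ^ d * (m / 1) * (Real.exp (-((K + 1) * ℓ)) + Real.exp (-((K + 1) * ℓ))) := by
        gcongr
    _ = 2 ^ (d + 1) / (m : ℝ) ^ K := by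
        rw [hexp, pow_succ]
        field_simp
        ring

theorem mainTheorem2 (n : ℕ) (hn : 1 ≤ n) (K : ℝ) :
    ∃ C A : ℝ, 0 < C ∧ 0 < A ∧ ∀ m : ℕ, 1 ≤ m →
      uniformPoints n m
          {a | ¬ FacetCountLE (spherePolytope a) (C * (m : ℝ) * Real.log (m : ℝ) ^ (n - 1))} ≤
        ENNReal.ofReal (A / (m : ℝ) ^ K) := by
  have : NeZero n := ⟨by omega⟩
  rcases hn.eq_or_lt with rfl | hn
  · -- In dimension one a facet is a single one of the `m` points.
    refine ⟨1, 1, one_pos, one_pos, fun m _ => ?_⟩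
    have hempty : {a : Fin m → sphere (0 : EuclideanSpace ℝ (Fin 1)) 1 |
        ¬ FacetCountLE (spherePolytope a) (1 * (m : ℝ) * Real.log (m : ℝ) ^ (1 - 1))} = ∅ := by
      refine Set.eq_empty_of_forall_notMem fun a ha => ha ?_
      exact facetCountLE_of_cover {()} (fun _ => Finset.univ) (k := m) (by simp)
        (fun F _ => ⟨(), by simp, by simp⟩) (by simp)
    rw [hempty, measure_empty]
    exact zero_le
  · -- A nonnegative exponent gives the stronger bound.
    have hK : 0 ≤ max K 0 := le_max_right _ _
    obtain ⟨C, hC, hlarge⟩ := exists_uniformPoints_real_le_of_large (n := n) hn hK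
    obtain ⟨M, hM⟩ := Filter.eventually_atTop.1 hlarge
    -- `A` is large enough to make the claim trivial for `m < M`.
    refine ⟨C, 2 ^ n + (M : ℝ) ^ max K 0, hC, by positivity, fun m hm => ?_⟩
    have hm1 : (1 : ℝ) ≤ m := by exact_mod_cast hm
    have hm0 : (0 : ℝ) < m := by linarith
    rw [← ofReal_measureReal]
    refine ENNReal.ofReal_le_ofReal ?_
    have hmono : (2 ^ n + (M : ℝ) ^ max K 0) / (m : ℝ) ^ max K 0 ≤
        (2 ^ n + (M : ℝ) ^ max K 0) / (m : ℝ) ^ K := by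
      gcongr
      exact le_max_left _ _
    refine le_trans ?_ hmono
    rcases le_or_gt M m with h | h
    · refine (hM m h).trans ?_
      gcongr
      exact le_add_of_nonneg_right (by positivity)
    · refine measureReal_le_one.trans ((one_le_div (by positivity)).2 ?_)
      have : (m : ℝ) ^ max K 0 ≤ (M : ℝ) ^ max K 0 := by gcongr
      linarith [show (0 : ℝ) < 2 ^ n by positivity]
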